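/- For integers $n\ge 1$ let $H_n=\sum_{j=1}^n \frac1j$ and $H_n^{(2)}=\sum_{j=1}^n\frac1{j^2}$, and let $\zeta$ denote the Riemann zeta function. Then the following two series converge (as limits of their partial sums) and \begin{align*} \sum_{n=1}^\infty \frac{H_n^3}{n+2}(-1)^n ={}& -\frac{5}{16}\zeta(4)+\frac98\zeta(3)\ln 2-\frac34\zeta(2)\ln^2 2+\frac14\ln^4 2-2\ln 2+3\ln^2 2-2\ln^3 2\\ &+3\zeta(2)\ln 2-\frac{15}{8}\zeta(3)-\zeta(2)+1,\\ \sum_{n=1}^\infty \frac{H_nH_n^{(2)}}{n+2}(-1)^n ={}& -\frac{5}{16}\zeta(4)-\frac14\zeta(2)\ln^2 2+\frac78\zeta(3)\ln 2-\frac98\zeta(3)+\zeta(2)\ln 2+2\ln 2-\ln^2 2-1. \end{align*} -/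

import Mathlib

/-- The harmonic number of order `m`: `H_n^{(m)} = ∑_{j=1}^{n} 1 / j^m`. -/
noncomputable def genHarmonic (m n : ℕ) : ℝ :=
  ∑ j ∈ Finset.Icc 1 n, 1 / (j : ℝ) ^ m

/-- The value `ζ(p)` of the Riemann zeta function at a natural number, as a real number. -/
noncomputable def zetaValue (p : ℕ) : ℝ :=
  (riemannZeta (p : ℂ)).re

/-- For `p > 1`, `ζ(p)` is the sum of the series `∑_{n ≥ 1} 1 / n^p`. -/
theorem hasSum_zetaValue {p : ℕ} (hp : 1 < p) :
    HasSum (fun n : ℕ => 1 / ((n : ℝ) + 1) ^ p) (zetaValue p) := by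
  have hs : Summable (fun n : ℕ => 1 / ((n : ℝ) + 1) ^ p) := by
    have h := (summable_nat_add_iff 1).mpr (Real.summable_one_div_nat_pow.mpr hp)
    simpa using h
  have hz : riemannZeta (p : ℂ) = ((∑' n : ℕ, 1 / ((n : ℝ) + 1) ^ p : ℝ) : ℂ) := by
    rw [zeta_eq_tsum_one_div_nat_add_one_cpow (by simpa using hp), Complex.ofReal_tsum]
    refine tsum_congr fun n => ?_
    push_cast
    rw [Complex.cpow_natCast]
  have he : zetaValue p = ∑' n : ℕ, 1 / ((n : ℝ) + 1) ^ p := by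
    rw [zetaValue, hz, Complex.ofReal_re]
  rw [he]
  exact hs.hasSum

/-- The series `∑_{n ≥ 1} a n` converges to `s`, as the limit of its partial sums
`∑_{n=1}^{N} a n` (absolute convergence is not required). -/
def SeriesConvergesTo (a : ℕ → ℝ) (s : ℝ) : Prop :=
  Filter.Tendsto (fun N : ℕ => ∑ n ∈ Finset.Icc 1 N, a n) Filter.atTop (nhds s)

/-! ### Harmonic-number series as formal power series -/

open PowerSeries

/-! Write p_k = ∑ X^n/n^k and w = ∑ H_{n-1} X^n/n². Differentiation shows, as formal identities,
that the series ∑ g(n-1) X^n/n with g = H₁, H₁², H₂, H₃, H₁H₂, H₁³ are polynomials in p₁, p₂, p₃, w.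
Writing H_{m-2} = H_{m-1} - 1/(m-1) and using partial fractions reduces the denominator n+2 to these
series.

Values at -1 are taken in Abel's sense (`AbelSum`), which respects sums and products even where
convergence at -1 is only conditional. Then p₁ gives -log 2, p₂ and p₃ give multiples of ζ(2) and
ζ(3), and ζ(2)² = (5/2)ζ(4). The one value not of this kind, w ↦ ζ(3)/8, comes from Tornheim's
double series (`hasSum_alternating_harmonic_div_sq`).

The two series do converge, because their unsigned terms tend to 0 with bounded variation; Abel's
theorem then equates the sum with the Abel value (`seriesConvergesTo_of_abelSum`). -/

theorem genHarmonic_zero (m : ℕ) : genHarmonic m 0 = 0 := by simp [genHarmonic]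

theorem genHarmonic_succ (m n : ℕ) :
    genHarmonic m (n + 1) = genHarmonic m n + 1 / ((n : ℝ) + 1) ^ m := by
  simp [genHarmonic, Finset.sum_Icc_succ_top]

/-- The power series `∑_{n ≥ 1} g (n - 1) / n ^ k * X ^ n`, for `k ≥ 1`. -/
noncomputable def eulerSeries (g : ℕ → ℝ) (k : ℕ) : PowerSeries ℝ :=
  PowerSeries.mk fun n => g (n - 1) / (n : ℝ) ^ k

theorem constantCoeff_eulerSeries (g : ℕ → ℝ) (k : ℕ) :
    constantCoeff (eulerSeries g (k + 1)) = 0 := by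
  rw [← coeff_zero_eq_constantCoeff_apply]
  simp [eulerSeries]

theorem X_mul_derivative_eulerSeries (g : ℕ → ℝ) (k : ℕ) :
    X * d⁄dX ℝ (eulerSeries g (k + 2)) = eulerSeries g (k + 1) := by
  ext n
  cases n with
  | zero => simp [eulerSeries]
  | succ n =>
    rw [coeff_succ_X_mul, coeff_derivative]
    simp only [eulerSeries, coeff_mk]
    have : ((n : ℝ) + 1) ≠ 0 := by positivity
    push_cast
    field_simp
    ring

theorem one_sub_X_mul_derivative_eulerSeries_one :
    (1 - X) * d⁄dX ℝ (eulerSeries (fun _ => 1) 1) = 1 := by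
  have h : d⁄dX ℝ (eulerSeries (fun _ => 1) 1) = PowerSeries.mk 1 := by
    ext n
    rw [coeff_derivative]
    simp only [eulerSeries, coeff_mk]
    have : ((n : ℝ) + 1) ≠ 0 := by positivity
    push_cast
    field_simp
    simp
  rw [h, mul_comm, mk_one_mul_one_sub_eq_one]

/-- The derivative is ∑ g(n) X^n, and multiplying by 1 - X takes differences. Truncated subtraction
makes the right side vanish at n = 0, hence the need for g 0 = 0. -/
theorem one_sub_X_mul_derivative_eulerSeries {g : ℕ → ℝ} (hg : g 0 = 0) :
    (1 - X) * d⁄dX ℝ (eulerSeries g 1) = PowerSeries.mk fun n => g n - g (n - 1) := by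
  have h : ∀ n, coeff n (d⁄dX ℝ (eulerSeries g 1)) = g n := by
    intro n
    rw [coeff_derivative]
    simp only [eulerSeries, coeff_mk]
    have : ((n : ℝ) + 1) ≠ 0 := by positivity
    push_cast
    field_simp
  ext n
  cases n with
  | zero => simpa [sub_mul, hg] using h 0
  | succ n => simp [sub_mul, coeff_succ_X_mul, h]

/-- Derivatives simplify after multiplication by X when the denominator is n^k with k ≥ 2, and by 1
- X when it is n; the product X(1 - X) serves both and can be cancelled. -/
theorem eq_of_X_mul_one_sub_X_mul_derivative_eq {f g : PowerSeries ℝ}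
    (h : X * (1 - X) * d⁄dX ℝ f = X * (1 - X) * d⁄dX ℝ g)
    (h0 : constantCoeff f = constantCoeff g) : f = g := by
  refine derivative.ext ?_ h0
  refine mul_left_cancel₀ (mul_ne_zero X_ne_zero ?_) h
  intro h1
  have := congrArg constantCoeff h1
  simp at this

local notation "H₁" => genHarmonic 1
local notation "H₂" => genHarmonic 2
local notation "H₃" => genHarmonic 3
local notation "p₁" => eulerSeries (fun _ => 1) 1
local notation "p₂" => eulerSeries (fun _ => 1) 2
local notation "p₃" => eulerSeries (fun _ => 1) 3
local notation "w" => eulerSeries H₁ 2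

theorem one_sub_X_mul_derivative_harmonic (k : ℕ) :
    (1 - X) * d⁄dX ℝ (eulerSeries (genHarmonic (k + 1)) 1) = eulerSeries (fun _ => 1) (k + 1) := by
  rw [one_sub_X_mul_derivative_eulerSeries (genHarmonic_zero _)]
  ext n
  cases n with
  | zero => simp [eulerSeries]
  | succ n => simp [eulerSeries, genHarmonic_succ]

theorem one_sub_X_mul_derivative_harmonic_sq :
    (1 - X) * d⁄dX ℝ (eulerSeries (fun n => H₁ n ^ 2) 1) = 2 * eulerSeries H₁ 1 + p₂ := by
  rw [one_sub_X_mul_derivative_eulerSeries (by simp [genHarmonic_zero]), two_mul]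
  ext n
  cases n with
  | zero => simp [eulerSeries]
  | succ n =>
    simp only [eulerSeries, coeff_mk, map_add, add_tsub_cancel_right, genHarmonic_succ]
    push_cast
    field_simp
    ring

theorem one_sub_X_mul_derivative_harmonic_cube :
    (1 - X) * d⁄dX ℝ (eulerSeries (fun n => H₁ n ^ 3) 1) =
      3 * eulerSeries (fun n => H₁ n ^ 2) 1 + 3 * w + p₃ := by
  rw [one_sub_X_mul_derivative_eulerSeries (by simp [genHarmonic_zero]),
    show (3 : PowerSeries ℝ) = C 3 from rfl]
  ext n
  cases n with
  | zero => simp [eulerSeries]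
  | succ n =>
    simp only [eulerSeries, coeff_mk, map_add, add_tsub_cancel_right, genHarmonic_succ,
      coeff_C_mul]
    push_cast
    field_simp
    ring

theorem one_sub_X_mul_derivative_harmonic_mul :
    (1 - X) * d⁄dX ℝ (eulerSeries (fun n => H₁ n * H₂ n) 1) = w + eulerSeries H₂ 1 + p₃ := by
  rw [one_sub_X_mul_derivative_eulerSeries (by simp [genHarmonic_zero])]
  ext n
  cases n with
  | zero => simp [eulerSeries]
  | succ n =>
    simp only [eulerSeries, coeff_mk, map_add, add_tsub_cancel_right, genHarmonic_succ]
    push_cast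
    field_simp
    ring

/-! ### Formal identities between products of polylogarithms and harmonic series -/

theorem eulerSeries_one_sq : p₁ ^ 2 = 2 * eulerSeries H₁ 1 := by
  apply eq_of_X_mul_one_sub_X_mul_derivative_eq
  · have h1 := one_sub_X_mul_derivative_eulerSeries_one
    have h2 := one_sub_X_mul_derivative_harmonic 0
    rw [two_mul]
    simp only [map_add, Derivation.leibniz, pow_two, smul_eq_mul] at *
    linear_combination 2 * X * p₁ * h1 - 2 * X * h2
  · simp [constantCoeff_eulerSeries]

/-- Differentiating p₁p₂ leaves an extra p₁², which the derivative of 2w cancels by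
`eulerSeries_one_sq`. -/
theorem eulerSeries_harmonic_two_eq : eulerSeries H₂ 1 = p₁ * p₂ - 2 * w := by
  apply eq_of_X_mul_one_sub_X_mul_derivative_eq
  · have h1 := one_sub_X_mul_derivative_eulerSeries_one
    have h2 := one_sub_X_mul_derivative_harmonic 1
    have h3 := X_mul_derivative_eulerSeries (fun _ => 1) 0
    have h4 := X_mul_derivative_eulerSeries H₁ 0
    have h5 := eulerSeries_one_sq
    rw [two_mul]
    simp only [map_add, map_sub, Derivation.leibniz, smul_eq_mul, zero_add] at *
    linear_combination X * h2 - X * p₂ * h1 - (1 - X) * p₁ * h3 + 2 * (1 - X) * h4 - (1 - X) * h5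
  · simp [constantCoeff_eulerSeries]

theorem eulerSeries_one_cube :
    p₁ ^ 3 = 3 * (eulerSeries (fun n => H₁ n ^ 2) 1 - eulerSeries H₂ 1) := by
  apply eq_of_X_mul_one_sub_X_mul_derivative_eq
  · have h1 := one_sub_X_mul_derivative_eulerSeries_one
    have h2 := one_sub_X_mul_derivative_harmonic 1
    have h3 := one_sub_X_mul_derivative_harmonic_sq
    have h5 := eulerSeries_one_sq
    rw [show (3 : PowerSeries ℝ) = 1 + 1 + 1 by norm_num]
    simp only [map_add, map_sub, Derivation.leibniz, smul_eq_mul, pow_succ, pow_zero, one_mul,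
      add_mul] at *
    linear_combination 3 * X * p₁ ^ 2 * h1 - 3 * X * h3 + 3 * X * h2 + 3 * X * h5
  · simp [constantCoeff_eulerSeries]

theorem eulerSeries_harmonic_three_eq :
    2 * eulerSeries H₃ 1 = 2 * p₁ * p₃ - p₂ ^ 2 := by
  apply eq_of_X_mul_one_sub_X_mul_derivative_eq
  · have h1 := one_sub_X_mul_derivative_eulerSeries_one
    have h2 := one_sub_X_mul_derivative_harmonic 2
    have h3 := X_mul_derivative_eulerSeries (fun _ => 1) 0
    have h4 := X_mul_derivative_eulerSeries (fun _ => 1) 1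
    simp only [two_mul, map_add, map_sub, Derivation.leibniz, smul_eq_mul, zero_add, pow_two,
      add_mul, Nat.reduceAdd] at *
    linear_combination 2 * X * h2 - 2 * X * p₃ * h1 - 2 * (1 - X) * p₁ * h4 + 2 * (1 - X) * p₂ * h3
  · simp [constantCoeff_eulerSeries]

theorem eulerSeries_harmonic_mul_eq :
    2 * eulerSeries (fun n => H₁ n * H₂ n) 1 =
      2 * p₁ * (w + eulerSeries H₂ 1 + p₃) - p₂ ^ 2 - p₁ ^ 2 * p₂ := by
  apply eq_of_X_mul_one_sub_X_mul_derivative_eq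
  · have h1 := one_sub_X_mul_derivative_eulerSeries_one
    have h2 := one_sub_X_mul_derivative_harmonic_mul
    have h3 := X_mul_derivative_eulerSeries (fun _ => 1) 0
    have h4 := X_mul_derivative_eulerSeries (fun _ => 1) 1
    have h5 := X_mul_derivative_eulerSeries H₁ 0
    have h6 := one_sub_X_mul_derivative_harmonic 1
    have h7 := eulerSeries_one_sq
    simp only [two_mul, map_add, map_sub, Derivation.leibniz, smul_eq_mul, zero_add, pow_two,
      add_mul, Nat.reduceAdd] at *
    linear_combination 2 * X * h2 - 2 * X * (w + eulerSeries H₂ 1 + p₃) * h1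
      - 2 * (1 - X) * p₁ * h5 - 2 * X * p₁ * h6 - 2 * (1 - X) * p₁ * h4
      + 2 * (1 - X) * p₂ * h3 + 2 * X * p₁ * p₂ * h1 + (1 - X) * p₁ ^ 2 * h3
      + (1 - X) * p₁ * h7
  · simp [constantCoeff_eulerSeries]

/-- p₁⁴/4! generates e₃(1, 1/2, …, 1/(n-1))/n, and Newton's identity gives 6e₃ = H₁³ - 3H₁H₂ + 2H₃.
-/
theorem eulerSeries_one_pow_four :
    p₁ ^ 4 = 4 * (eulerSeries (fun n => H₁ n ^ 3) 1
      - 3 * eulerSeries (fun n => H₁ n * H₂ n) 1 + 2 * eulerSeries H₃ 1) := by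
  apply eq_of_X_mul_one_sub_X_mul_derivative_eq
  · have h1 := one_sub_X_mul_derivative_eulerSeries_one
    have h2 := one_sub_X_mul_derivative_harmonic_mul
    have h3 := one_sub_X_mul_derivative_harmonic_cube
    have h4 := one_sub_X_mul_derivative_harmonic 2
    have h5 := eulerSeries_one_cube
    rw [show (4 : PowerSeries ℝ) = 1 + 1 + 1 + 1 by norm_num,
      show (3 : PowerSeries ℝ) = 1 + 1 + 1 by norm_num]
    simp only [two_mul, map_add, map_sub, Derivation.leibniz, smul_eq_mul, pow_succ,
      pow_zero, one_mul, add_mul, Nat.reduceAdd] at *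
    linear_combination 4 * X * p₁ ^ 3 * h1 - 4 * X * h3 + 12 * X * h2 - 8 * X * h4 + 4 * X * h5
  · simp [constantCoeff_eulerSeries]

/-! ### Reducing the denominator n + 2 -/

/-- The power series `∑_{n ≥ 0} g n / (n + 2) * X ^ (n + 2)`. -/
noncomputable def shiftedEulerSeries (g : ℕ → ℝ) : PowerSeries ℝ :=
  PowerSeries.mk fun n => g (n - 2) / (n : ℝ)

/-- At X^m, expand (H_{m-1} - 1/(m-1))³/m and split each 1/((m-1)^j m) into partial fractions. Terms
over powers of m-1 become X times a series, after rewriting H_{m-1} = H_{m-2} + 1/(m-1). The final X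
corrects the coefficient of p₁ at m = 1. -/
theorem shiftedEulerSeries_harmonic_cube_eq :
    shiftedEulerSeries (fun n => H₁ n ^ 3) = eulerSeries (fun n => H₁ n ^ 3) 1
      - 3 * (X * (eulerSeries (fun n => H₁ n ^ 2) 1 + 2 * w + p₃)
        - eulerSeries (fun n => H₁ n ^ 2) 1)
      + 3 * (X * (w + p₃) - X * (eulerSeries H₁ 1 + p₂) + eulerSeries H₁ 1)
      - (X * p₃ - X * p₂ + X * p₁ - p₁ + X) := by
  rw [show (3 : PowerSeries ℝ) = C 3 from rfl, show (2 : PowerSeries ℝ) = C 2 from rfl]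
  ext n
  rcases n with _ | _ | n
  · simp [shiftedEulerSeries, eulerSeries, genHarmonic_zero]
  · simp [shiftedEulerSeries, eulerSeries, genHarmonic_zero, coeff_succ_X_mul, coeff_X]
  · have h : (n : ℝ) + 1 + 1 ≠ 0 := by positivity
    simp [shiftedEulerSeries, eulerSeries, genHarmonic_succ, coeff_succ_X_mul, coeff_X]
    field_simp
    ring

theorem shiftedEulerSeries_harmonic_mul_eq :
    shiftedEulerSeries (fun n => H₁ n * H₂ n) = eulerSeries (fun n => H₁ n * H₂ n) 1
      - (X * (w + p₃) - X * (eulerSeries H₁ 1 + p₂) + eulerSeries H₁ 1)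
      - (X * (eulerSeries H₂ 1 + p₃) - eulerSeries H₂ 1)
      + (X * p₃ - X * p₂ + X * p₁ - p₁ + X) := by
  ext n
  rcases n with _ | _ | n
  · simp [shiftedEulerSeries, eulerSeries, genHarmonic_zero]
  · simp [shiftedEulerSeries, eulerSeries, genHarmonic_zero, coeff_succ_X_mul, coeff_X]
  · have h : (n : ℝ) + 1 + 1 ≠ 0 := by positivity
    simp [shiftedEulerSeries, eulerSeries, genHarmonic_succ, coeff_succ_X_mul, coeff_X]
    field_simp
    ring

/-! ### Abel summation at -1 -/

/-- `f` converges on the open unit disc and its value at `-t` tends to `l` as `t → 1⁻`. -/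
def AbelSum (f : PowerSeries ℝ) (l : ℝ) : Prop :=
  (∀ x : ℝ, |x| < 1 → Summable fun n => ‖coeff n f * x ^ n‖) ∧
    Filter.Tendsto (fun t : ℝ => ∑' n, coeff n f * (-t) ^ n) (nhdsWithin 1 (Set.Iio 1)) (nhds l)

theorem eventually_abs_neg_lt_one :
    ∀ᶠ t : ℝ in nhdsWithin 1 (Set.Iio 1), |(-t)| < 1 := by
  have h : ∀ᶠ t : ℝ in nhdsWithin 1 (Set.Iio 1), t ∈ Set.Ioo (0 : ℝ) 1 :=
    Ioo_mem_nhdsLT (by norm_num)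
  filter_upwards [h] with t ht
  rw [abs_neg, abs_of_pos ht.1]
  exact ht.2

namespace AbelSum
variable {f g : PowerSeries ℝ} {a b : ℝ}

theorem add (hf : AbelSum f a) (hg : AbelSum g b) : AbelSum (f + g) (a + b) := by
  refine ⟨fun x hx => ?_, ?_⟩
  · have := (hf.1 x hx).of_norm.add (hg.1 x hx).of_norm
    simpa only [map_add, add_mul] using this.norm
  · refine (hf.2.add hg.2).congr' ?_
    filter_upwards [eventually_abs_neg_lt_one] with t ht
    rw [← (hf.1 _ ht).of_norm.tsum_add (hg.1 _ ht).of_norm]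
    simp only [map_add, add_mul]

theorem const_mul (c : ℝ) (hf : AbelSum f a) : AbelSum (C c * f) (c * a) := by
  refine ⟨fun x hx => ?_, ?_⟩
  · have := (hf.1 x hx).of_norm.mul_left c
    simpa only [coeff_C_mul, mul_assoc] using this.norm
  · refine (hf.2.const_mul c).congr fun t => ?_
    simp only [coeff_C_mul, mul_assoc, tsum_mul_left]

theorem neg (hf : AbelSum f a) : AbelSum (-f) (-a) := by
  simpa using hf.const_mul (-1)

theorem sub (hf : AbelSum f a) (hg : AbelSum g b) : AbelSum (f - g) (a - b) := by
  simpa only [sub_eq_add_neg] using hf.add hg.neg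

theorem coeff_mul_mul_pow (f g : PowerSeries ℝ) (x : ℝ) (n : ℕ) :
    ∑ kl ∈ Finset.HasAntidiagonal.antidiagonal n, coeff kl.1 f * x ^ kl.1 * (coeff kl.2 g * x ^ kl.2) =
      coeff n (f * g) * x ^ n := by
  rw [coeff_mul, Finset.sum_mul]
  refine Finset.sum_congr rfl fun kl hkl => ?_
  rw [← Finset.HasAntidiagonal.mem_antidiagonal.mp hkl, pow_add]
  ring

/-- Cauchy products are taken inside the disc, where convergence is absolute; only then does t → 1⁻.
-/
theorem mul (hf : AbelSum f a) (hg : AbelSum g b) : AbelSum (f * g) (a * b) := by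
  refine ⟨fun x hx => ?_, ?_⟩
  · simpa only [coeff_mul_mul_pow] using
      summable_norm_sum_mul_antidiagonal_of_summable_norm (hf.1 x hx) (hg.1 x hx)
  · refine (hf.2.mul hg.2).congr' ?_
    filter_upwards [eventually_abs_neg_lt_one] with t ht
    rw [tsum_mul_tsum_eq_tsum_sum_antidiagonal_of_summable_norm (hf.1 _ ht) (hg.1 _ ht)]
    simp only [coeff_mul_mul_pow]

theorem pow (hf : AbelSum f a) (n : ℕ) : AbelSum (f ^ (n + 1)) (a ^ (n + 1)) := by
  induction n with
  | zero => simpa using hf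
  | succ n ih => simpa only [pow_succ _ (n + 1)] using ih.mul hf

theorem unique (hf : AbelSum f a) (hg : AbelSum f b) : a = b :=
  tendsto_nhds_unique hf.2 hg.2

theorem of_tendsto
    (h : Filter.Tendsto (fun N => ∑ n ∈ Finset.range N, coeff n f * (-1) ^ n) Filter.atTop
      (nhds a)) : AbelSum f a := by
  have key : ∀ x : ℝ, ∀ n, coeff n f * (-1) ^ n * (-x) ^ n = coeff n f * x ^ n := fun x n => by
    rw [mul_assoc, ← mul_pow]
    simp
  refine ⟨fun x hx => ?_, ?_⟩
  · have := summable_powerSeries_of_norm_lt_one h.cauchySeq (z := -x) (by simpa using hx)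
    simpa only [key] using this.norm
  · refine (Real.tendsto_tsum_powerSeries_nhdsWithin_lt h).congr fun t => ?_
    simp only [← key (-t), neg_neg]

theorem of_hasSum (h : HasSum (fun n => coeff n f * (-1) ^ n) a) : AbelSum f a :=
  of_tendsto h.tendsto_sum_nat

theorem X : AbelSum X (-1) := by
  apply of_hasSum
  convert hasSum_ite_eq (1 : ℕ) (-1 : ℝ) using 2 with n
  rw [coeff_X]
  split_ifs with h <;> simp [h]

end AbelSum

/-! ### Convergence of alternating series -/

/-- A null sequence of bounded variation has a convergent alternating series. -/
theorem exists_tendsto_alternating_of_summable_sub {a : ℕ → ℝ}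
    (h0 : Filter.Tendsto a Filter.atTop (nhds 0)) (hs : Summable fun n => |a n - a (n + 1)|) :
    ∃ l, Filter.Tendsto (fun N => ∑ n ∈ Finset.range N, a n * (-1) ^ n) Filter.atTop (nhds l) := by
  have hs' : Summable fun n => (a n - a (n + 1)) * (-1) ^ n :=
    Summable.of_norm (by simpa [abs_mul] using hs)
  obtain ⟨s, hs'⟩ := hs'
  have h1 : Filter.Tendsto (fun N => a N * (-1) ^ N) Filter.atTop (nhds 0) := by
    rw [tendsto_zero_iff_norm_tendsto_zero] at h0 ⊢
    simpa [abs_mul] using h0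
  -- Summation by parts: adding the alternating sum to its shift leaves differences and two boundary
  -- terms.
  have key : ∀ N, ∑ n ∈ Finset.range N, a n * (-1) ^ n =
      (a 0 + ∑ n ∈ Finset.range N, (a n - a (n + 1)) * (-1) ^ n - a N * (-1) ^ N) / 2 := by
    intro N
    induction N with
    | zero => simp
    | succ N ih =>
      rw [Finset.sum_range_succ, Finset.sum_range_succ, ih]
      ring
  refine ⟨(a 0 + s - 0) / 2, ?_⟩
  simp only [key]
  exact ((hs'.tendsto_sum_nat.const_add _).sub h1).div_const 2

theorem HasSum.of_eq {ι : Type*} {f g : ι → ℝ} {a : ℝ} (h : HasSum f a) (e : ∀ i, g i = f i) :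
    HasSum g a :=
  funext e ▸ h

theorem genHarmonic_nonneg (m n : ℕ) : 0 ≤ genHarmonic m n :=
  Finset.sum_nonneg fun _ _ => by positivity

/-! ### Alternating zeta values and Tornheim's double series -/

/-- `∑_{n ≥ 1} (-1) ^ n / n ^ p = (2 ^ (1 - p) - 1) ζ(p)`. -/
theorem hasSum_alternating_zetaValue {p : ℕ} (hp : 1 < p) :
    HasSum (fun n : ℕ => (-1 : ℝ) ^ (n + 1) / ((n : ℝ) + 1) ^ p)
      (2 * (1 / 2 ^ p) * zetaValue p - zetaValue p) := by
  have h := hasSum_zetaValue hp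
  have hinj : Function.Injective fun i : ℕ => 2 * i + 1 := fun a b hab => by
    simp only at hab; omega
  -- The weight is 2 on even denominators and 0 on odd ones.
  have he : HasSum (fun n : ℕ => (1 + (-1 : ℝ) ^ (n + 1)) * (1 / ((n : ℝ) + 1) ^ p))
      (2 * (1 / 2 ^ p) * zetaValue p) := by
    rw [← hinj.hasSum_iff]
    · refine (h.mul_left (2 * (1 / 2 ^ p))).of_eq fun i => ?_
      have h1 : (-1 : ℝ) ^ (2 * i + 1 + 1) = 1 := by rw [add_assoc, ← mul_add_one, pow_mul]; simp
      have h2 : ((2 * i + 1 : ℕ) : ℝ) + 1 = 2 * ((i : ℝ) + 1) := by push_cast; ring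
      rw [Function.comp_apply, h1, h2, mul_pow]
      field_simp
      norm_num
    · intro n hn
      have : Even n := by
        by_contra ho
        obtain ⟨k, hk⟩ := Nat.not_even_iff_odd.mp ho
        exact hn ⟨k, hk.symm⟩
      simp [this.add_one.neg_one_pow]
  refine (he.sub h).of_eq fun n => ?_
  ring

/-- The summand `1 / (n k (n + k))` of Tornheim's double series, with `n`, `k` shifted by one. -/
noncomputable def tornheim (q : ℕ × ℕ) : ℝ :=
  1 / (((q.1 : ℝ) + 1) * ((q.2 : ℝ) + 1) * ((q.1 : ℝ) + q.2 + 2))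

theorem tornheim_nonneg (q : ℕ × ℕ) : 0 ≤ tornheim q := by
  unfold tornheim; positivity

/-- Since √x √y ≤ x + y, the summand is at most x^(-3/2) y^(-3/2). -/
theorem summable_tornheim : Summable tornheim := by
  have h : Summable fun n : ℕ => 1 / ((n : ℝ) + 1) ^ (3 / 2 : ℝ) := by
    have := (summable_nat_add_iff 1).mpr
      (Real.summable_one_div_nat_rpow (p := 3 / 2).mpr (by norm_num))
    simpa using this
  refine Summable.of_nonneg_of_le tornheim_nonneg (fun q => ?_)
    (h.mul_of_nonneg h (fun _ => by positivity) (fun _ => by positivity))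
  have hx : (0 : ℝ) < (q.1 : ℝ) + 1 := by positivity
  have hy : (0 : ℝ) < (q.2 : ℝ) + 1 := by positivity
  have e : ∀ x : ℝ, 0 < x → x ^ (3 / 2 : ℝ) = x * √x := fun x hx => by
    rw [Real.sqrt_eq_rpow, ← Real.rpow_one_add' hx.le (by norm_num)]; norm_num
  rw [e _ hx, e _ hy, ← one_div_mul_one_div, tornheim, one_div_mul_one_div, one_div_mul_one_div]
  refine one_div_le_one_div_of_le (by positivity) ?_
  have hxy : √((q.1 : ℝ) + 1) * √((q.2 : ℝ) + 1) ≤ (q.1 : ℝ) + q.2 + 2 := by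
    nlinarith [sq_nonneg (√((q.1 : ℝ) + 1) - √((q.2 : ℝ) + 1)), Real.sq_sqrt hx.le,
      Real.sq_sqrt hy.le]
  calc _ = ((q.1 : ℝ) + 1) * ((q.2 : ℝ) + 1) * (√((q.1 : ℝ) + 1) * √((q.2 : ℝ) + 1)) := by ring
    _ ≤ _ := by gcongr

/-- `∑_{k ≥ 1} (1 / k - 1 / (n + k)) = H_n`. -/
theorem hasSum_one_div_sub_one_div (n : ℕ) :
    HasSum (fun k : ℕ => 1 / ((k : ℝ) + 1) - 1 / ((n : ℝ) + k + 1)) (genHarmonic 1 n) := by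
  induction n with
  | zero => simp [genHarmonic_zero, hasSum_zero]
  | succ n ih =>
    have h : HasSum (fun k : ℕ => 1 / ((n : ℝ) + k + 1) - 1 / ((n : ℝ) + k + 1 + 1))
        (1 / ((n : ℝ) + 1)) := by
      rw [hasSum_iff_tendsto_nat_of_nonneg]
      · have h1 : ∀ N : ℕ, ∑ k ∈ Finset.range N,
            (1 / ((n : ℝ) + k + 1) - 1 / ((n : ℝ) + k + 1 + 1)) =
            1 / ((n : ℝ) + 1) - 1 / ((N : ℝ) + n + 1) := fun N => by
          have := Finset.sum_range_sub' (fun k : ℕ => 1 / ((n : ℝ) + k + 1)) N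
          push_cast at this
          simp only [← add_assoc, add_zero] at this
          rw [← add_comm (n : ℝ) N, ← this]
        simp only [h1]
        have h2 : Filter.Tendsto (fun N : ℕ => 1 / ((N : ℝ) + n + 1)) Filter.atTop (nhds 0) := by
          have := (Filter.tendsto_add_atTop_iff_nat n).mpr
            (tendsto_one_div_add_atTop_nhds_zero_nat (𝕜 := ℝ))
          simpa using this
        simpa using h2.const_sub (1 / ((n : ℝ) + 1))
      · intro k
        have : (0 : ℝ) < (n : ℝ) + k + 1 := by positivity
        rw [sub_nonneg]
        exact one_div_le_one_div_of_le this (by linarith)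
    rw [genHarmonic_succ, pow_one]
    refine (ih.add h).of_eq fun k => ?_
    push_cast
    ring

theorem hasSum_tornheim_row (n : ℕ) :
    HasSum (fun k => tornheim (n, k)) (genHarmonic 1 (n + 1) / ((n : ℝ) + 1) ^ 2) := by
  refine ((hasSum_one_div_sub_one_div (n + 1)).div_const (((n : ℝ) + 1) ^ 2)).of_eq fun k => ?_
  have h1 : (n : ℝ) + 1 ≠ 0 := by positivity
  have h2 : (k : ℝ) + 1 ≠ 0 := by positivity
  have h3 : (n : ℝ) + 1 + k + 1 ≠ 0 := by positivity
  have h4 : (n : ℝ) + k + 2 ≠ 0 := by positivity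
  simp only [tornheim]
  push_cast
  field_simp
  ring

/-- On n + k = N, 1/(nk) = (1/n + 1/k)/N. -/
theorem sum_antidiagonal_tornheim (m : ℕ) :
    ∑ q ∈ Finset.HasAntidiagonal.antidiagonal m, tornheim q = 2 * genHarmonic 1 (m + 1) / ((m : ℝ) + 2) ^ 2 := by
  have h1 : ∀ q ∈ Finset.HasAntidiagonal.antidiagonal m, tornheim q =
      (1 / ((q.1 : ℝ) + 1) + 1 / ((q.2 : ℝ) + 1)) / ((m : ℝ) + 2) ^ 2 := fun q hq => by
    have hm : (m : ℝ) = q.1 + q.2 := by exact_mod_cast (Finset.HasAntidiagonal.mem_antidiagonal.mp hq).symm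
    have h1 : (q.1 : ℝ) + 1 ≠ 0 := by positivity
    have h2 : (q.2 : ℝ) + 1 ≠ 0 := by positivity
    have h4 : (q.1 : ℝ) + q.2 + 2 ≠ 0 := by positivity
    rw [hm, tornheim]
    field_simp
    ring
  have h2 : ∑ q ∈ Finset.HasAntidiagonal.antidiagonal m, 1 / ((q.1 : ℝ) + 1) = genHarmonic 1 (m + 1) := by
    rw [Finset.Nat.sum_antidiagonal_eq_sum_range_succ_mk, Nat.succ_eq_add_one]
    generalize m + 1 = N
    induction N with
    | zero => simp [genHarmonic_zero]
    | succ N ih => rw [Finset.sum_range_succ, ih, genHarmonic_succ, pow_one]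
  have h3 : ∑ q ∈ Finset.HasAntidiagonal.antidiagonal m, 1 / ((q.2 : ℝ) + 1) = genHarmonic 1 (m + 1) := by
    rw [← h2, ← Finset.Nat.sum_antidiagonal_swap]
    rfl
  rw [Finset.sum_congr rfl h1, ← Finset.sum_div, Finset.sum_add_distrib, h2, h3, two_mul]

theorem summable_mul_tornheim {s : ℕ × ℕ → ℝ} (hs : ∀ q, |s q| = 1) :
    Summable fun q => s q * tornheim q :=
  Summable.of_norm (by simpa [abs_mul, hs, abs_of_nonneg, tornheim_nonneg] using summable_tornheim)

theorem hasSum_harmonic_tornheim {s : ℕ → ℝ} (hs : ∀ n, |s n| = 1) :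
    HasSum (fun n : ℕ => s n * genHarmonic 1 (n + 1) / ((n : ℝ) + 1) ^ 2)
      (∑' q : ℕ × ℕ, s q.1 * tornheim q) := by
  refine (summable_mul_tornheim (s := fun q => s q.1) fun q => hs _).hasSum.prod_fiberwise
    fun n => ?_
  rw [mul_div_assoc]
  exact (hasSum_tornheim_row n).mul_left _

theorem hasSum_antidiagonal_tornheim {s : ℕ → ℝ} (hs : ∀ n, |s n| = 1) :
    HasSum (fun n : ℕ => 2 * (s n * genHarmonic 1 (n + 1) / ((n : ℝ) + 2) ^ 2))
      (∑' q : ℕ × ℕ, s (q.1 + q.2) * tornheim q) := by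
  have h := (Finset.HasAntidiagonal.sigmaAntidiagonalEquivProd (A := ℕ)).hasSum_iff.mpr
    (summable_mul_tornheim (s := fun q => s (q.1 + q.2)) fun q => hs _).hasSum
  refine h.sigma fun n => ?_
  have h2 : 2 * (s n * genHarmonic 1 (n + 1) / ((n : ℝ) + 2) ^ 2) =
      ∑ q ∈ Finset.HasAntidiagonal.antidiagonal n, s (q.1 + q.2) * tornheim q := by
    rw [Finset.sum_congr rfl fun q hq => by rw [Finset.HasAntidiagonal.mem_antidiagonal.mp hq],
      ← Finset.mul_sum, sum_antidiagonal_tornheim]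
    ring
  rw [h2]
  exact Finset.hasSum _ _

/-- Only pairs of even denominators survive, with weight 4; homogeneity of degree -3 contributes
1/8. -/
theorem hasSum_even_tornheim :
    HasSum (fun q : ℕ × ℕ => (1 + (-1 : ℝ) ^ (q.1 + 1)) * (1 + (-1 : ℝ) ^ (q.2 + 1)) * tornheim q)
      (1 / 2 * ∑' q, tornheim q) := by
  have hinj : Function.Injective fun q : ℕ × ℕ => (2 * q.1 + 1, 2 * q.2 + 1) := by
    rintro ⟨a, b⟩ ⟨c, d⟩ h
    simp only [Prod.mk.injEq] at h ⊢
    omega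
  rw [← hinj.hasSum_iff]
  · refine (summable_tornheim.hasSum.mul_left (1 / 2)).of_eq fun q => ?_
    have h1 : (-1 : ℝ) ^ (2 * q.1 + 1 + 1) = 1 := by rw [add_assoc, ← mul_add_one, pow_mul]; simp
    have h2 : (-1 : ℝ) ^ (2 * q.2 + 1 + 1) = 1 := by rw [add_assoc, ← mul_add_one, pow_mul]; simp
    simp only [Function.comp_apply, h1, h2, tornheim]
    push_cast
    have h1 : (q.1 : ℝ) + 1 ≠ 0 := by positivity
    have h2 : (q.2 : ℝ) + 1 ≠ 0 := by positivity
    have h4 : (q.1 : ℝ) + q.2 + 2 ≠ 0 := by positivity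
    have h3 : (2 * (q.1 : ℝ) + 1 + 1) * (2 * (q.2 : ℝ) + 1 + 1) *
      (2 * (q.1 : ℝ) + 1 + (2 * (q.2 : ℝ) + 1) + 2) =
      8 * (((q.1 : ℝ) + 1) * ((q.2 : ℝ) + 1) * ((q.1 : ℝ) + q.2 + 2)) := by ring
    rw [h3]
    field_simp
    norm_num
  · rintro ⟨n, k⟩ hq
    have : Even n ∨ Even k := by
      by_contra! ho
      obtain ⟨i, hi⟩ := Nat.not_even_iff_odd.mp ho.1
      obtain ⟨j, hj⟩ := Nat.not_even_iff_odd.mp ho.2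
      exact hq ⟨(i, j), by simp [hi, hj]⟩
    rcases this with h | h <;> simp [h.add_one.neg_one_pow]

/-- `∑_{n ≥ 1} (-1) ^ n H_{n - 1} / n ^ 2 = ζ(3) / 8`. -/
theorem hasSum_alternating_harmonic_div_sq :
    HasSum (fun n : ℕ => (-1 : ℝ) ^ (n + 1) * genHarmonic 1 n / ((n : ℝ) + 1) ^ 2)
      (zetaValue 3 / 8) := by
  have habs : ∀ n : ℕ, |(-1 : ℝ) ^ n| = 1 := fun n => by simp
  have habs1 : ∀ _ : ℕ, |(1 : ℝ)| = 1 := fun n => by simp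
  have row1 := (hasSum_harmonic_tornheim habs1).sub (hasSum_zetaValue (p := 3) (by norm_num))
  have rowa := (hasSum_harmonic_tornheim fun n => habs (n + 1)).sub
    (hasSum_alternating_zetaValue (p := 3) (by norm_num))
  have anti1 := hasSum_antidiagonal_tornheim habs1
  have antia := hasSum_antidiagonal_tornheim habs
  -- The n = 0 term vanishes because H_0 = 0, so the index can be moved by one.
  have shift : ∀ (s : ℕ → ℝ) (l : ℝ),
      HasSum (fun n : ℕ => 2 * (s n * genHarmonic 1 (n + 1) / ((n : ℝ) + 2) ^ 2)) (2 * l) ↔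
      HasSum (fun n : ℕ => s (n - 1) * genHarmonic 1 n / ((n : ℝ) + 1) ^ 2) l := fun s l => by
    rw [← hasSum_nat_add_iff' (f := fun n : ℕ => s (n - 1) * genHarmonic 1 n / ((n : ℝ) + 1) ^ 2) 1]
    rw [hasSum_mul_left_iff two_ne_zero]
    simp [genHarmonic_zero, add_assoc, one_add_one_eq_two]
  have e1 : HasSum (fun n : ℕ => 1 * genHarmonic 1 n / ((n : ℝ) + 1) ^ 2)
      (∑' q, 1 * tornheim q - zetaValue 3) := by
    refine row1.of_eq fun n => ?_
    rw [genHarmonic_succ]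
    field_simp
    ring
  have ea : HasSum (fun n : ℕ => (-1 : ℝ) ^ (n + 1) * genHarmonic 1 n / ((n : ℝ) + 1) ^ 2)
      (∑' q : ℕ × ℕ, (-1) ^ (q.1 + 1) * tornheim q
        - (2 * (1 / 2 ^ 3) * zetaValue 3 - zetaValue 3)) := by
    refine rowa.of_eq fun n => ?_
    rw [genHarmonic_succ]
    field_simp
    ring
  have f1 := anti1.unique ((shift (fun _ => 1) _).mpr e1)
  have fa := antia.unique ((shift (fun n => (-1) ^ n) _).mpr (by
    refine ea.of_eq fun n => ?_
    rcases n with _ | n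
    · simp [genHarmonic_zero]
    · simp [pow_succ]))
  have hswap : HasSum (fun q : ℕ × ℕ => (-1 : ℝ) ^ (q.2 + 1) * tornheim q)
      (∑' q : ℕ × ℕ, (-1) ^ (q.1 + 1) * tornheim q) := by
    rw [← (Equiv.prodComm ℕ ℕ).hasSum_iff]
    refine (summable_mul_tornheim (s := fun q => (-1) ^ (q.1 + 1)) fun q => habs _).hasSum.of_eq
      fun q => ?_
    simp only [tornheim, Function.comp_apply, Equiv.prodComm_apply, Prod.fst_swap, Prod.snd_swap]
    ring
  have htot := (((summable_mul_tornheim (s := fun _ => 1) fun q => habs1 0).hasSum.add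
    (summable_mul_tornheim (s := fun q => (-1) ^ (q.1 + 1)) fun q => habs _).hasSum).add
    hswap).add (summable_mul_tornheim (s := fun q => (-1) ^ (q.1 + q.2)) fun q => habs _).hasSum
  have heven := hasSum_even_tornheim.unique (htot.of_eq fun q => by ring)
  simp only [one_mul] at f1 heven
  convert ea using 1
  -- With T the Tornheim sum, R its sum signed by (-1)^n and A the target: T = 2(T - ζ(3)), R = A -
  -- (3/4)ζ(3), the sum signed by (-1)^(n+k) is 2A, and T + 2R + 2A = T/2. Hence A = ζ(3)/8.
  linarith

/-! ### Abel values of the basic series -/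

theorem abelSum_eulerSeries {g : ℕ → ℝ} {k : ℕ} {l : ℝ}
    (h : HasSum (fun n : ℕ => (-1 : ℝ) ^ (n + 1) * g n / ((n : ℝ) + 1) ^ (k + 1)) l) :
    AbelSum (eulerSeries g (k + 1)) l := by
  apply AbelSum.of_hasSum
  rw [← hasSum_nat_add_iff' 1]
  simp only [Finset.range_one, Finset.sum_singleton, eulerSeries, coeff_mk]
  have h0 : g (0 - 1) / ((0 : ℕ) : ℝ) ^ (k + 1) * (-1) ^ 0 = 0 := by simp
  rw [h0, sub_zero]
  refine h.of_eq fun n => ?_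
  push_cast
  ring

theorem abelSum_eulerSeries_one {k : ℕ} :
    AbelSum (eulerSeries (fun _ => 1) (k + 2))
      (2 * (1 / 2 ^ (k + 2)) * zetaValue (k + 2) - zetaValue (k + 2)) := by
  refine abelSum_eulerSeries ((hasSum_alternating_zetaValue (by omega)).of_eq fun n => ?_)
  rw [mul_one]

/-- At -1 the series converges only conditionally, so the value is read off from -log(1 - x) on the
disc. -/
theorem abelSum_eulerSeries_one_one : AbelSum (eulerSeries (fun _ => 1) 1) (-Real.log 2) := by
  have key : ∀ x : ℝ, |x| < 1 →
      HasSum (fun n => coeff n (eulerSeries (fun _ => 1) 1) * x ^ n) (-Real.log (1 - x)) := by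
    intro x hx
    rw [← hasSum_nat_add_iff' 1]
    simp only [Finset.range_one, Finset.sum_singleton, eulerSeries, coeff_mk]
    have h0 : (1 : ℝ) / ((0 : ℕ) : ℝ) ^ 1 * x ^ 0 = 0 := by simp
    rw [h0, sub_zero]
    refine (Real.hasSum_pow_div_log_of_abs_lt_one hx).of_eq fun n => ?_
    push_cast
    ring
  refine ⟨fun x hx => (key x hx).summable.norm, ?_⟩
  have hc : Filter.Tendsto (fun t : ℝ => -Real.log (1 - -t)) (nhdsWithin 1 (Set.Iio 1))
      (nhds (-Real.log 2)) := by
    have : ContinuousAt (fun t : ℝ => -Real.log (1 - -t)) 1 := by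
      refine (ContinuousAt.log (by fun_prop) (by norm_num)).neg
    have h2 := this.tendsto
    rw [show (1 : ℝ) - -1 = 2 by norm_num] at h2
    exact h2.mono_left nhdsWithin_le_nhds
  refine hc.congr' ?_
  filter_upwards [eventually_abs_neg_lt_one] with t ht
  exact (key _ ht).tsum_eq.symm

theorem zetaValue_two_sq : zetaValue 2 ^ 2 = 5 / 2 * zetaValue 4 := by
  have h2 : zetaValue 2 = Real.pi ^ 2 / 6 := by
    rw [zetaValue, Nat.cast_ofNat, riemannZeta_two]
    rw [← Complex.ofReal_re (Real.pi ^ 2 / 6)]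
    push_cast
    rfl
  have h4 : zetaValue 4 = Real.pi ^ 4 / 90 := by
    rw [zetaValue, Nat.cast_ofNat, riemannZeta_four]
    rw [← Complex.ofReal_re (Real.pi ^ 4 / 90)]
    push_cast
    rfl
  rw [h2, h4]
  ring

/-! ### Growth bounds and passage from Abel values to convergence -/

/-- The exponent 1/6 makes the cube grow only like a square root. The constant is 8 = 6 + 1 + 1,
from log x ≤ 6x^(1/6). -/
theorem genHarmonic_one_add_one_le (n : ℕ) :
    genHarmonic 1 n + 1 ≤ 8 * ((n : ℝ) + 1) ^ (1 / 6 : ℝ) := by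
  have h1 : genHarmonic 1 n ≤ 1 + Real.log ((n : ℝ) + 1) := by
    have h := harmonic_le_one_add_log n
    have e : ((harmonic n : ℚ) : ℝ) = genHarmonic 1 n := by
      rw [harmonic_eq_sum_Icc, genHarmonic]
      push_cast
      simp
    rw [e] at h
    rcases n with _ | n
    · simp [genHarmonic_zero]
    · refine h.trans ?_
      gcongr
      linarith
  have h2 := Real.log_le_rpow_div (x := (n : ℝ) + 1) (ε := 1 / 6) (by positivity) (by norm_num)
  have h3 : 1 ≤ ((n : ℝ) + 1) ^ (1 / 6 : ℝ) :=
    Real.one_le_rpow (by linarith [n.cast_nonneg (α := ℝ)]) (by norm_num)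
  linarith

theorem genHarmonic_one_add_one_cube_le (n : ℕ) :
    (genHarmonic 1 n + 1) ^ 3 ≤ 512 * ((n : ℝ) + 1) ^ (1 / 2 : ℝ) := by
  have h := pow_le_pow_left₀ (by linarith [genHarmonic_nonneg 1 n]) (genHarmonic_one_add_one_le n) 3
  refine h.trans_eq ?_
  rw [mul_pow, ← Real.rpow_natCast (((n : ℝ) + 1) ^ (1 / 6 : ℝ)), ← Real.rpow_mul (by positivity)]
  norm_num

theorem tendsto_harmonic_cube_div :
    Filter.Tendsto (fun n : ℕ => (genHarmonic 1 n + 1) ^ 3 / ((n : ℝ) + 1)) Filter.atTop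
      (nhds 0) := by
  have h : Filter.Tendsto (fun n : ℕ => 512 * ((n : ℝ) + 1) ^ (-(1 / 2) : ℝ)) Filter.atTop
      (nhds 0) := by
    have := ((tendsto_rpow_neg_atTop (y := 1 / 2) (by norm_num)).comp
      (Filter.tendsto_atTop_add_const_right _ (1 : ℝ) tendsto_natCast_atTop_atTop)).const_mul 512
    simpa using this
  refine squeeze_zero (fun n => ?_) (fun n => ?_) h
  · have := genHarmonic_nonneg 1 n
    positivity
  · have hn : (0 : ℝ) < (n : ℝ) + 1 := by positivity
    rw [div_le_iff₀ hn, mul_assoc, ← Real.rpow_add_one hn.ne']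
    exact (genHarmonic_one_add_one_cube_le n).trans_eq (by norm_num)

theorem summable_harmonic_cube_div_sq :
    Summable fun n : ℕ => (genHarmonic 1 n + 1) ^ 3 / ((n : ℝ) + 1) ^ 2 := by
  have h : Summable fun n : ℕ => 512 * (1 / ((n : ℝ) + 1) ^ (3 / 2 : ℝ)) := by
    have := (summable_nat_add_iff 1).mpr
      (Real.summable_one_div_nat_rpow (p := 3 / 2).mpr (by norm_num))
    simpa using this.mul_left 512
  refine Summable.of_nonneg_of_le (fun n => ?_) (fun n => ?_) h
  · have := genHarmonic_nonneg 1 n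
    positivity
  · have hn : (0 : ℝ) < (n : ℝ) + 1 := by positivity
    rw [div_le_iff₀ (by positivity), mul_assoc, ← Real.rpow_natCast _ 2, one_div,
      ← Real.rpow_neg hn.le, ← Real.rpow_add hn]
    exact (genHarmonic_one_add_one_cube_le n).trans_eq (by norm_num)

/-- The bounds on g and its increments give bounded variation of g(n)/(n+2), hence some limit; by
Abel's theorem that limit is also an Abel value, so uniqueness forces it to be l. -/
theorem seriesConvergesTo_of_abelSum {g : ℕ → ℝ} {l : ℝ} (h0 : g 0 = 0)
    (hg : ∀ n, |g n| ≤ (genHarmonic 1 n + 1) ^ 3)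
    (hd : ∀ n, |g (n + 1) - g n| ≤ (genHarmonic 1 n + 1) ^ 3 / ((n : ℝ) + 1))
    (hl : AbelSum (shiftedEulerSeries g) l) :
    SeriesConvergesTo (fun n => g n / ((n : ℝ) + 2) * (-1) ^ n) l := by
  have hH : ∀ n, 0 ≤ (genHarmonic 1 n + 1) ^ 3 := fun n => by
    have := genHarmonic_nonneg 1 n
    positivity
  obtain ⟨l', hl'⟩ := exists_tendsto_alternating_of_summable_sub
    (a := fun n => g n / ((n : ℝ) + 2))
    (squeeze_zero_norm (fun n => by
      rw [Real.norm_eq_abs, abs_div, abs_of_pos (by positivity : (0 : ℝ) < (n : ℝ) + 2)]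
      exact div_le_div₀ (hH n) (hg n) (by positivity) (by linarith)) tendsto_harmonic_cube_div)
    (Summable.of_nonneg_of_le (fun _ => abs_nonneg _) (fun n => by
      have hn : (0 : ℝ) < (n : ℝ) + 1 := by positivity
      have e : g n / ((n : ℝ) + 2) - g (n + 1) / (((n + 1 : ℕ) : ℝ) + 2) =
          g n / (((n : ℝ) + 2) * ((n : ℝ) + 3)) - (g (n + 1) - g n) / ((n : ℝ) + 3) := by
        push_cast
        rw [show (n : ℝ) + 1 + 2 = n + 3 by ring]
        field_simp
        ring
      rw [e]
      refine (abs_sub _ _).trans ?_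
      rw [abs_div, abs_div, abs_of_pos (by positivity : (0 : ℝ) < (n : ℝ) + 3),
        abs_of_pos (by positivity : (0 : ℝ) < ((n : ℝ) + 2) * ((n : ℝ) + 3)), two_mul]
      refine add_le_add (div_le_div₀ (hH n) (hg n) (by positivity) (by nlinarith)) ?_
      rw [pow_two, ← div_div]
      exact div_le_div₀ (div_nonneg (hH n) hn.le) (hd n) hn (by linarith))
      (summable_harmonic_cube_div_sq.mul_left 2))
  -- Coefficients 0 and 1 vanish since g 0 = 0, and a shift by two preserves the sign.
  have hs : ∀ N, ∑ n ∈ Finset.range (N + 2), coeff n (shiftedEulerSeries g) * (-1) ^ n =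
      ∑ n ∈ Finset.range N, g n / ((n : ℝ) + 2) * (-1) ^ n := fun N => by
    rw [Finset.sum_range_succ', Finset.sum_range_succ']
    simp only [add_assoc, one_add_one_eq_two, shiftedEulerSeries, coeff_mk, add_tsub_cancel_right,
      zero_tsub, h0, zero_div, zero_mul, add_zero, Nat.reduceSubDiff, zero_add, pow_add]
    simp
  have hl2 : AbelSum (shiftedEulerSeries g) l' := by
    apply AbelSum.of_tendsto
    rw [← Filter.tendsto_add_atTop_iff_nat 2]
    simpa only [hs] using hl'
  rw [hl.unique hl2, SeriesConvergesTo]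
  refine ((Filter.tendsto_add_atTop_iff_nat 1).mpr hl').congr fun N => ?_
  rw [Finset.sum_range_succ', Finset.range_eq_Ico, Finset.sum_Ico_add' (fun n : ℕ =>
    g n / ((n : ℝ) + 2) * (-1) ^ n) 0 N 1]
  simp [h0]
  rfl

theorem genHarmonic_two_le (n : ℕ) : genHarmonic 2 n ≤ genHarmonic 1 n := by
  refine Finset.sum_le_sum fun j hj => ?_
  have hj : (1 : ℝ) ≤ j := by exact_mod_cast (Finset.mem_Icc.mp hj).1
  exact one_div_le_one_div_of_le (by positivity) (pow_le_pow_right₀ hj (by norm_num))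

/-! ### Abel values of the harmonic series -/

theorem AbelSum.two_mul {f : PowerSeries ℝ} {a : ℝ} (hf : AbelSum f a) :
    AbelSum (2 * f) (2 * a) :=
  hf.const_mul 2

theorem AbelSum.three_mul {f : PowerSeries ℝ} {a : ℝ} (hf : AbelSum f a) :
    AbelSum (3 * f) (3 * a) :=
  hf.const_mul 3

theorem abelSum_p2 : AbelSum p₂ (-(1 / 2) * zetaValue 2) := by
  convert abelSum_eulerSeries_one (k := 0) using 1
  norm_num
  ring

theorem abelSum_p3 : AbelSum p₃ (-(3 / 4) * zetaValue 3) := by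
  convert abelSum_eulerSeries_one (k := 1) using 1
  norm_num
  ring

theorem abelSum_harmonic_div_sq : AbelSum w (zetaValue 3 / 8) :=
  abelSum_eulerSeries hasSum_alternating_harmonic_div_sq

theorem abelSum_harmonic : AbelSum (eulerSeries H₁ 1) (1 / 2 * Real.log 2 ^ 2) := by
  have h : eulerSeries H₁ 1 = C (1 / 2) * p₁ ^ 2 := by
    rw [eulerSeries_one_sq, ← mul_assoc, show (2 : PowerSeries ℝ) = C 2 from rfl, ← map_mul]
    norm_num
  rw [h]
  convert (abelSum_eulerSeries_one_one.pow 1).const_mul (1 / 2) using 1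
  ring

theorem abelSum_harmonic_two : AbelSum (eulerSeries H₂ 1)
    (1 / 2 * zetaValue 2 * Real.log 2 - zetaValue 3 / 4) := by
  rw [eulerSeries_harmonic_two_eq]
  convert (abelSum_eulerSeries_one_one.mul abelSum_p2).sub
    (abelSum_harmonic_div_sq.two_mul) using 1
  ring

theorem abelSum_harmonic_sq : AbelSum (eulerSeries (fun n => H₁ n ^ 2) 1)
    (-(1 / 3) * Real.log 2 ^ 3 + 1 / 2 * zetaValue 2 * Real.log 2 - zetaValue 3 / 4) := by
  have h : eulerSeries (fun n => H₁ n ^ 2) 1 = C (1 / 3) * p₁ ^ 3 + eulerSeries H₂ 1 := by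
    rw [eulerSeries_one_cube, ← mul_assoc, show (3 : PowerSeries ℝ) = C 3 from rfl, ← map_mul]
    norm_num
  rw [h]
  convert ((abelSum_eulerSeries_one_one.pow 2).const_mul (1 / 3)).add abelSum_harmonic_two using 1
  ring

theorem abelSum_harmonic_three : AbelSum (eulerSeries H₃ 1)
    (3 / 4 * zetaValue 3 * Real.log 2 - 5 / 16 * zetaValue 4) := by
  have h : eulerSeries H₃ 1 = C (1 / 2) * (2 * (p₁ * p₃) - p₂ ^ 2) := by
    rw [show (2 * (p₁ * p₃) - p₂ ^ 2 : PowerSeries ℝ) = 2 * eulerSeries H₃ 1 by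
      linear_combination -eulerSeries_harmonic_three_eq, ← mul_assoc,
      show (2 : PowerSeries ℝ) = C 2 from rfl, ← map_mul]
    norm_num
  rw [h]
  convert (((abelSum_eulerSeries_one_one.mul abelSum_p3).two_mul).sub
    (abelSum_p2.pow 1)).const_mul (1 / 2) using 1
  linear_combination 1 / 8 * zetaValue_two_sq

theorem abelSum_harmonic_mul : AbelSum (eulerSeries (fun n => H₁ n * H₂ n) 1)
    (-(5 / 16) * zetaValue 4 - 1 / 4 * zetaValue 2 * Real.log 2 ^ 2
      + 7 / 8 * zetaValue 3 * Real.log 2) := by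
  have h : eulerSeries (fun n => H₁ n * H₂ n) 1 =
      C (1 / 2) * (2 * (p₁ * (w + eulerSeries H₂ 1 + p₃)) - p₂ ^ 2 - p₁ ^ 2 * p₂) := by
    rw [show (2 * (p₁ * (w + eulerSeries H₂ 1 + p₃)) - p₂ ^ 2 - p₁ ^ 2 * p₂ : PowerSeries ℝ) =
      2 * eulerSeries (fun n => H₁ n * H₂ n) 1 by
      linear_combination -eulerSeries_harmonic_mul_eq, ← mul_assoc,
      show (2 : PowerSeries ℝ) = C 2 from rfl, ← map_mul]
    norm_num
  rw [h]
  convert ((((abelSum_eulerSeries_one_one.mul ((abelSum_harmonic_div_sq.add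
    abelSum_harmonic_two).add abelSum_p3)).two_mul).sub (abelSum_p2.pow 1)).sub
    ((abelSum_eulerSeries_one_one.pow 1).mul abelSum_p2)).const_mul (1 / 2) using 1
  linear_combination 1 / 8 * zetaValue_two_sq

theorem abelSum_harmonic_cube : AbelSum (eulerSeries (fun n => H₁ n ^ 3) 1)
    (-(5 / 16) * zetaValue 4 + 9 / 8 * zetaValue 3 * Real.log 2
      - 3 / 4 * zetaValue 2 * Real.log 2 ^ 2 + 1 / 4 * Real.log 2 ^ 4) := by
  have h : eulerSeries (fun n => H₁ n ^ 3) 1 =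
      C (1 / 4) * p₁ ^ 4 + 3 * eulerSeries (fun n => H₁ n * H₂ n) 1 - 2 * eulerSeries H₃ 1 := by
    rw [eulerSeries_one_pow_four, ← mul_assoc, show (4 : PowerSeries ℝ) = C 4 from rfl, ← map_mul]
    norm_num
    ring
  rw [h]
  convert (((abelSum_eulerSeries_one_one.pow 3).const_mul (1 / 4)).add
    (abelSum_harmonic_mul.three_mul)).sub (abelSum_harmonic_three.two_mul) using 1
  ring

/-! ### Assembly -/

theorem mainTheorem9 :
    SeriesConvergesTo
      (fun n : ℕ => genHarmonic 1 n ^ 3 / ((n : ℝ) + 2) * (-1 : ℝ) ^ n)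
      (-(5 / 16) * zetaValue 4 + 9 / 8 * zetaValue 3 * Real.log 2
        - 3 / 4 * zetaValue 2 * Real.log 2 ^ 2 + 1 / 4 * Real.log 2 ^ 4 - 2 * Real.log 2
        + 3 * Real.log 2 ^ 2 - 2 * Real.log 2 ^ 3 + 3 * zetaValue 2 * Real.log 2
        - 15 / 8 * zetaValue 3 - zetaValue 2 + 1) ∧
    SeriesConvergesTo
      (fun n : ℕ => genHarmonic 1 n * genHarmonic 2 n / ((n : ℝ) + 2) * (-1 : ℝ) ^ n)
      (-(5 / 16) * zetaValue 4 - 1 / 4 * zetaValue 2 * Real.log 2 ^ 2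
        + 7 / 8 * zetaValue 3 * Real.log 2 - 9 / 8 * zetaValue 3
        + zetaValue 2 * Real.log 2 + 2 * Real.log 2 - Real.log 2 ^ 2 - 1) := by
  have hx := AbelSum.X
  have h1 := abelSum_eulerSeries_one_one
  have h2 := abelSum_p2
  have h3 := abelSum_p3
  have hw := abelSum_harmonic_div_sq
  have hu : ∀ n : ℕ, (0 : ℝ) < 1 / ((n : ℝ) + 1) ∧ 1 / ((n : ℝ) + 1) ≤ 1 := fun n =>
    ⟨by positivity, by
      rw [div_le_one (by positivity)]
      linarith [n.cast_nonneg (α := ℝ)]⟩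
  -- Abel values of ∑ X^m/((m-1)³m) and ∑ H_{m-1} X^m/((m-1)²m), m ≥ 2, shared by both reductions.
  have hrem := (((hx.mul h3).sub (hx.mul h2)).add (hx.mul h1)).sub h1 |>.add hx
  have hmid := ((hx.mul (hw.add h3)).sub (hx.mul (abelSum_harmonic.add h2))).add abelSum_harmonic
  constructor
  · refine seriesConvergesTo_of_abelSum (g := fun n => H₁ n ^ 3) (by simp [genHarmonic_zero])
      (fun n => ?_) (fun n => ?_) ?_
    · have := genHarmonic_nonneg 1 n
      rw [abs_of_nonneg (by positivity)]
      gcongr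
      linarith
    · have hH := genHarmonic_nonneg 1 n
      obtain ⟨hu0, hu1⟩ := hu n
      simp only [genHarmonic_succ, pow_one]
      rw [div_eq_mul_one_div (_ ^ 3)]
      set u := 1 / ((n : ℝ) + 1)
      rw [show (H₁ n + u) ^ 3 - H₁ n ^ 3 = (3 * H₁ n ^ 2 + 3 * H₁ n * u + u ^ 2) * u by ring,
        abs_of_nonneg (by positivity)]
      gcongr
      -- As u ≤ 1, the factor is at most 3H² + 3H + 1 ≤ (H + 1)³.
      nlinarith [pow_nonneg hH 3, mul_le_mul_of_nonneg_left hu1 hH]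
    · rw [shiftedEulerSeries_harmonic_cube_eq]
      convert ((abelSum_harmonic_cube.sub (((hx.mul ((abelSum_harmonic_sq.add
        (hw.two_mul)).add h3)).sub abelSum_harmonic_sq).three_mul)).add
        (hmid.three_mul)).sub hrem using 1
      ring
  · refine seriesConvergesTo_of_abelSum (g := fun n => H₁ n * H₂ n) (by simp [genHarmonic_zero])
      (fun n => ?_) (fun n => ?_) ?_
    · have hH := genHarmonic_nonneg 1 n
      have hK := genHarmonic_nonneg 2 n
      have hle := genHarmonic_two_le n
      rw [abs_of_nonneg (by positivity)]
      nlinarith [pow_nonneg hH 3, mul_le_mul_of_nonneg_left hle hH]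
    · have hH := genHarmonic_nonneg 1 n
      have hK := genHarmonic_nonneg 2 n
      have hle := genHarmonic_two_le n
      obtain ⟨hu0, hu1⟩ := hu n
      simp only [genHarmonic_succ, pow_one, ← one_div_pow]
      rw [div_eq_mul_one_div (_ ^ 3)]
      set u := 1 / ((n : ℝ) + 1)
      rw [show (H₁ n + u) * (H₂ n + u ^ 2) - H₁ n * H₂ n = (H₁ n * u + H₂ n + u ^ 2) * u by ring,
        abs_of_nonneg (by positivity)]
      gcongr
      -- As u ≤ 1 and H₂ ≤ H₁, the factor is at most 2H₁ + 1 ≤ (H₁ + 1)³.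
      nlinarith [pow_nonneg hH 3, mul_le_mul_of_nonneg_left hu1 hH]
    · rw [shiftedEulerSeries_harmonic_mul_eq]
      convert ((abelSum_harmonic_mul.sub hmid).sub
        ((hx.mul (abelSum_harmonic_two.add h3)).sub abelSum_harmonic_two)).add hrem using 1
      ring
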